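/- **Setting.** Let $\chi(s_1,s_2,s_3)=s_1+s_2+s_3+s_1s_3 \pmod 2$. For $t\in\mathbb N_0$ let $M_t:\{0,1\}^{\mathbb Z}\to\{0,1\}^{\mathbb Z}$ be the map that simultaneously replaces $s_x$ by $\chi(s_{x-1},s_x,s_{x+1})$ at all sites $x\equiv t \pmod 2$ and leaves the other sites unchanged (the rule 54 reversible cellular automaton). Observables are the continuous functions on $\{0,1\}^{\mathbb Z}$; $[\alpha]_x(\underline s)=\delta_{\alpha,s_x}$, and $[s_{-t}s_{-t+1}\cdots s_t]=[s_{-t}]_{-t}[s_{-t+1}]_{-t+1}\cdots[s_t]_t$. Time evolution is $a^0=a$, $a^{t+1}=U(t)a^t$ with the automorphism $U(t)a=a\circ M_t$; equivalently $U(t)$ is the product of the local automorphisms $U_x$, $x\equiv t\pmod 2$, which act by $[\alpha\,\beta\,\gamma]_x\mapsto[\alpha\,\chi(\alpha,\beta,\gamma)\,\gamma]_x$ (three consecutive sites centred at $x$). Write $[1]=[1]_0$. Let $\mathcal V$ be the complex vector space with basis $|c,w,n,a\rangle$, $c,w\in\mathbb N_0$, $n\in\{0,1,2\}$, $a\in\{0,1\}$,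 with dual basis $\langle c,w,n,a|$; $A^T$ is the transpose in this basis. Let $$\mathbf c^+=\sum_{c,w,n,a}|c+1,w,n,a\rangle\langle c,w,n,a|,\quad \mathbf c^-=(\mathbf c^+)^T,\quad \mathbf w^+=\sum_{c,w,n,a}|c,w+1,n,a\rangle\langle c,w,n,a|,\quad \mathbf w^-=(\mathbf w^+)^T,$$ $$\mathbf e_{c_2w_2n_2a_2,\,c_1w_1n_1a_1}=|c_2,w_2,n_2,a_2\rangle\langle c_1,w_1,n_1,a_1|,\qquad \mathbf e_{n_2a_2,\,n_1a_1}=\sum_{c,w}|c,w,n_2,a_2\rangle\langle c,w,n_1,a_1| .$$ Note that $\mathbf w^+\mathbf w^-$ is the projector onto the vectors with $w\ge1$. Define $$\begin{aligned} V_0&=\mathbf e_{00,00}+\mathbf e_{10,00}+\mathbf e_{20,00}+\mathbf c^+\mathbf e_{10,01}+\mathbf w^+\mathbf w^-\mathbf e_{01,01}+\mathbf c^+\mathbf w^+\mathbf e_{11,01}+\mathbf w^+\mathbf w^-\mathbf e_{21,01}\\&\quad+\mathbf e_{0001,0001}+\mathbf e_{0011,0001}+\mathbf e_{0021,0001},\\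 V_1&=\mathbf e_{00,10}+\mathbf e_{10,20}+\mathbf e_{20,20}+\mathbf e_{10,21}+\mathbf e_{20,21}+\mathbf w^+\mathbf w^-\mathbf e_{01,11}+\mathbf w^+\mathbf e_{11,21}+\mathbf w^+\mathbf e_{21,21}\\&\quad+\mathbf e_{0001,0011}+\mathbf e_{0011,0021}+\mathbf e_{0021,0021},\\ W_0&=\mathbf c^-\mathbf w^+(\mathbf e_{00,00}+\mathbf e_{10,00}+\mathbf e_{20,00})+\mathbf w^+\mathbf e_{10,01}+\mathbf w^+\mathbf e_{01,01}+\mathbf c^+(\mathbf w^+)^2\mathbf e_{11,01}+\mathbf w^+\mathbf e_{21,01}\\&\quad+\mathbf e_{1111,0001}+\mathbf e_{0001,0001}+\mathbf e_{0011,0001}+\mathbf e_{0021,0001},\\ W_1&=\mathbf c^-\mathbf w^+(\mathbf e_{00,10}+\mathbf e_{10,20}+\mathbf e_{20,20})+\mathbf w^+\mathbf e_{01,11}+\mathbf c^+\mathbf w^+\mathbf e_{11,21}+\mathbf c^+\mathbf w^+\mathbf e_{21,21}\\&\quad+\mathbf e_{0001,0011}+\mathbf e_{0011,0021}+\mathbf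 e_{0021,0021},\\ V_0'&=V_0^T-(\mathbf e_{0001,1111}+\mathbf e_{0101,1211}+\mathbf e_{0101,1110}),\qquad V_1'=V_1^T,\\ W_0'&=W_0^T-(\mathbf e_{0001,1111}+\mathbf e_{0001,1211}),\\ W_1'&=W_1^T-(\mathbf e_{0021,1111}+\mathbf e_{0021,1121}+\mathbf e_{0121,1211}+\mathbf e_{0121,1221}), \end{aligned}$$ and $$\langle l(t)|=\langle0,t,0,0|,\qquad |r\rangle=|0,0,0,1\rangle+|0,0,1,1\rangle+|0,0,2,1\rangle,\qquad |r'(t)\rangle=|0,t+1,0,0\rangle,$$ $$\langle l'|=\langle0,0,0,1|+\langle0,0,1,1|+\langle0,0,2,1|+\langle0,1,0,1|+\langle0,1,2,1|.$$ **Theorem 1.** For every integer $t\ge1$, $$[1]^t=\sum_{s_{-t},\ldots,s_t\in\{0,1\}}c_{s_{-t},\ldots,s_t}(t)\,[s_{-t}s_{-t+1}\cdots s_t],$$ where $$c_{s_{-t},\ldots,s_t}(t)=\langle l(t)|V_{s_{-t}}W_{s_{-t+1}}V_{s_{-t+2}}\cdots W_{s_{t-1}}V_{s_t}|r\rangle+\langle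 l'|V'_{s_{-t}}W'_{s_{-t+1}}V'_{s_{-t+2}}\cdots W'_{s_{t-1}}V'_{s_t}|r'(t)\rangle .$$ -/

import Mathlib

noncomputable section

namespace Rule54

/-! ### The cellular automaton -/

/-- Configurations of empty (`0`) and occupied (`1`) sites on the infinite chain. -/
abbrev Config : Type := ℤ → ZMod 2

/-- The local rule 54, `χ(s₁,s₂,s₃) = s₁ + s₂ + s₃ + s₁ s₃ (mod 2)`. -/
def chi (s₁ s₂ s₃ : ZMod 2) : ZMod 2 := s₁ + s₂ + s₃ + s₁ * s₃

/-- One time step at time `t`: the sites `x ≡ t (mod 2)` are updated simultaneously by the local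
rule and all the other sites are left unchanged, so that this is `Mᵉ` for even `t` and `Mᵒ` for
odd `t`. -/
def step (t : ℕ) : C(Config, Config) where
  toFun s x := if (2 : ℤ) ∣ x - t then chi (s (x - 1)) (s x) (s (x + 1)) else s x
  continuous_toFun := by
    refine continuous_pi fun x => ?_
    by_cases h : (2 : ℤ) ∣ x - t
    · simp only [h, if_true, chi]
      fun_prop
    · simp only [h, if_false]
      fun_prop

/-! ### Observables and their time evolution -/

/-- The commutative quasilocal C*-algebra of observables: since the configuration space carries the
product of the discrete topologies, the norm closure of the algebra of functions depending on
finitely many sites is the algebra of all continuous functions. -/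
abbrev Observable : Type := C(Config, ℂ)

/-- The one-site basis observable `[α]_x`, with `[α]_x(s) = δ_{α, s_x}`. -/
def site (x : ℤ) (α : ZMod 2) : Observable where
  toFun s := if s x = α then 1 else 0
  continuous_toFun :=
    (continuous_of_discreteTopology (f := fun β : ZMod 2 => if β = α then (1 : ℂ) else 0)).comp
      (continuous_apply x)

/-- The observable `[α₁ α₂ … α_r]_x = [α₁]_{x - ⌊r/2⌋} [α₂]_{x - ⌊r/2⌋ + 1} ⋯` on `r` consecutive
sites centred around `x`. -/
def cylinder {r : ℕ} (x : ℤ) (α : Fin r → ZMod 2) : Observable :=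
  ∏ i : Fin r, site (x - ((r / 2 : ℕ) : ℤ) + ((i : ℕ) : ℤ)) (α i)

/-- The automorphism `U(t)`, the product of the commuting local automorphisms `U_x` over all sites
`x ≡ t (mod 2)`. -/
def propagator (t : ℕ) : Observable →⋆ₐ[ℂ] Observable :=
  ContinuousMap.compStarAlgHom' ℂ ℂ (step t)

/-- `U(t)` acts on one-site observables at the sites that are not updated as the identity. -/
theorem propagator_site (t : ℕ) (x : ℤ) (hx : ¬ (2 : ℤ) ∣ x - t) (α : ZMod 2) :
    propagator t (site x α) = site x α := by
  ext s
  change (if (step t s) x = α then (1 : ℂ) else 0) = if s x = α then 1 else 0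
  have : (step t s) x = s x := if_neg hx
  rw [this]

/-- `U(t)` acts on the three-site observables centred at the updated sites by
`[α β γ]_x ↦ [α χ(α,β,γ) γ]_x`. -/
theorem propagator_cylinder (t : ℕ) (x : ℤ) (hx : (2 : ℤ) ∣ x - t) (α β γ : ZMod 2) :
    propagator t (cylinder x ![α, β, γ]) = cylinder x ![α, chi α β γ, γ] := by
  have h₀ : ¬ (2 : ℤ) ∣ x - 1 - t := by omega
  have h₂ : ¬ (2 : ℤ) ∣ x + 1 - t := by omega
  have e₀ : x - ((3 / 2 : ℕ) : ℤ) + ((0 : ℕ) : ℤ) = x - 1 := by norm_num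
  have e₁ : x - ((3 / 2 : ℕ) : ℤ) + ((1 : ℕ) : ℤ) = x := by norm_num
  have e₂ : x - ((3 / 2 : ℕ) : ℤ) + ((2 : ℕ) : ℤ) = x + 1 := by norm_num; ring
  have key : ∀ δ : ZMod 2, cylinder x ![α, δ, γ] = site (x - 1) α * site x δ * site (x + 1) γ := by
    intro δ
    rw [cylinder, Fin.prod_univ_three]
    change site (x - ((3 / 2 : ℕ) : ℤ) + ((0 : ℕ) : ℤ)) α * site (x - ((3 / 2 : ℕ) : ℤ) + ((1 : ℕ) : ℤ)) δ
      * site (x - ((3 / 2 : ℕ) : ℤ) + ((2 : ℕ) : ℤ)) γ = _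
    rw [e₀, e₁, e₂]
  rw [key, key, map_mul, map_mul, propagator_site t _ h₀, propagator_site t _ h₂]
  ext s
  have h₁ : (step t s) x = chi (s (x - 1)) (s x) (s (x + 1)) := if_pos hx
  change (if s (x - 1) = α then (1 : ℂ) else 0) * (if (step t s) x = β then (1 : ℂ) else 0)
      * (if s (x + 1) = γ then (1 : ℂ) else 0)
    = (if s (x - 1) = α then (1 : ℂ) else 0) * (if s x = chi α β γ then (1 : ℂ) else 0)
      * (if s (x + 1) = γ then (1 : ℂ) else 0)
  rw [h₁]
  by_cases ha : s (x - 1) = α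
  · by_cases hc : s (x + 1) = γ
    · have : ∀ a b c d : ZMod 2, chi a b c = d ↔ b = chi a d c := by decide
      simp only [ha, hc, this]
    · simp [hc]
  · simp [ha]

/-- The time-evolved observable `a^t`: `a^0 = a` and `a^{t+1} = U(t) a^t`. -/
def evolve (a : Observable) : ℕ → Observable
  | 0 => a
  | t + 1 => propagator t (evolve a t)

/-! ### The auxiliary space -/

/-- Labels `(c, w, n, a)` of the basis of the auxiliary space. -/
abbrev Label : Type := ℕ × ℕ × Fin 3 × Fin 2

/-- The auxiliary space `lsp {|c,w,n,a⟩}`. -/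
abbrev Aux : Type := Label →₀ ℂ

/-- The basis vector `|c,w,n,a⟩`. -/
def ket (c w : ℕ) (n : Fin 3) (a : Fin 2) : Aux := Finsupp.single (c, w, n, a) 1

/-- The dual basis vector `⟨c,w,n,a|`. -/
def bra (c w : ℕ) (n : Fin 3) (a : Fin 2) : Aux →ₗ[ℂ] ℂ := Finsupp.lapply (c, w, n, a)

/-- The linear operator with prescribed values on the basis vectors. -/
def ofBasis (v : ℕ → ℕ → Fin 3 → Fin 2 → Aux) : Module.End ℂ Aux :=
  Finsupp.linearCombination ℂ fun i : Label => v i.1 i.2.1 i.2.2.1 i.2.2.2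

open Classical in
/-- The transpose of an operator whose matrix in the basis of kets has finitely many nonzero
entries in every row (so that the transpose preserves the linear span of the kets). Every operator
transposed below is of this kind. -/
def transpose (A : Module.End ℂ Aux) : Module.End ℂ Aux :=
  Finsupp.linearCombination ℂ fun i : Label =>
    if h : (Function.support fun j : Label => A (Finsupp.single j 1) i).Finite then
      Finsupp.ofSupportFinite (fun j : Label => A (Finsupp.single j 1) i) h
    else 0

/-- The matrix entries of the transpose are the transposed matrix entries. -/
theorem transpose_entry (A : Module.End ℂ Aux)
    (hA : ∀ i : Label, (Function.support fun j : Label => A (Finsupp.single j 1) i).Finite)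
    (i j : Label) :
    transpose A (Finsupp.single i 1) j = A (Finsupp.single j 1) i := by
  rw [transpose, Finsupp.linearCombination_single, one_smul, dif_pos (hA i)]
  rfl

/-- The ladder operator `c⁺ = ∑ |c+1,w,n,a⟩⟨c,w,n,a|`. -/
def cUp : Module.End ℂ Aux := ofBasis fun c w n a => ket (c + 1) w n a

/-- The ladder operator `c⁻ = (c⁺)ᵀ`. -/
def cDown : Module.End ℂ Aux := transpose cUp

/-- The ladder operator `w⁺ = ∑ |c,w+1,n,a⟩⟨c,w,n,a|`. -/
def wUp : Module.End ℂ Aux := ofBasis fun c w n a => ket c (w + 1) n a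

/-- The ladder operator `w⁻ = (w⁺)ᵀ`. -/
def wDown : Module.End ℂ Aux := transpose wUp

/-- `e_{n₂a₂,n₁a₁} = ∑_{c,w} |c,w,n₂,a₂⟩⟨c,w,n₁,a₁|`. -/
def e (n₂ : Fin 3) (a₂ : Fin 2) (n₁ : Fin 3) (a₁ : Fin 2) : Module.End ℂ Aux :=
  ofBasis fun c w n a => if n = n₁ ∧ a = a₁ then ket c w n₂ a₂ else 0

/-- `e_{c₂w₂n₂a₂,c₁w₁n₁a₁} = |c₂,w₂,n₂,a₂⟩⟨c₁,w₁,n₁,a₁|`. -/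
def E (c₂ w₂ : ℕ) (n₂ : Fin 3) (a₂ : Fin 2) (c₁ w₁ : ℕ) (n₁ : Fin 3) (a₁ : Fin 2) :
    Module.End ℂ Aux :=
  (bra c₁ w₁ n₁ a₁).smulRight (ket c₂ w₂ n₂ a₂)

/-! ### The matrices of the matrix product ansatz

The product `wUp * wDown` is the projector onto the vectors with `w ≥ 1`. -/

/-- The operator `V₀`. -/
def V₀ : Module.End ℂ Aux :=
  e 0 0 0 0 + e 1 0 0 0 + e 2 0 0 0
    + cUp * e 1 0 0 1
    + wUp * wDown * e 0 1 0 1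
    + cUp * wUp * e 1 1 0 1
    + wUp * wDown * e 2 1 0 1
    + E 0 0 0 1 0 0 0 1 + E 0 0 1 1 0 0 0 1 + E 0 0 2 1 0 0 0 1

/-- The operator `V₁`. -/
def V₁ : Module.End ℂ Aux :=
  e 0 0 1 0 + e 1 0 2 0 + e 2 0 2 0
    + e 1 0 2 1 + e 2 0 2 1
    + wUp * wDown * e 0 1 1 1
    + wUp * e 1 1 2 1 + wUp * e 2 1 2 1
    + E 0 0 0 1 0 0 1 1 + E 0 0 1 1 0 0 2 1 + E 0 0 2 1 0 0 2 1

/-- The operator `W₀`. -/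
def W₀ : Module.End ℂ Aux :=
  cDown * wUp * (e 0 0 0 0 + e 1 0 0 0 + e 2 0 0 0)
    + wUp * e 1 0 0 1
    + wUp * e 0 1 0 1
    + cUp * wUp ^ 2 * e 1 1 0 1
    + wUp * e 2 1 0 1
    + E 1 1 1 1 0 0 0 1
    + E 0 0 0 1 0 0 0 1 + E 0 0 1 1 0 0 0 1 + E 0 0 2 1 0 0 0 1

/-- The operator `W₁`. -/
def W₁ : Module.End ℂ Aux :=
  cDown * wUp * (e 0 0 1 0 + e 1 0 2 0 + e 2 0 2 0)
    + wUp * e 0 1 1 1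
    + cUp * wUp * e 1 1 2 1 + cUp * wUp * e 2 1 2 1
    + E 0 0 0 1 0 0 1 1 + E 0 0 1 1 0 0 2 1 + E 0 0 2 1 0 0 2 1

/-- The operator `V'₀`. -/
def V₀' : Module.End ℂ Aux :=
  transpose V₀ - (E 0 0 0 1 1 1 1 1 + E 0 1 0 1 1 2 1 1 + E 0 1 0 1 1 1 1 0)

/-- The operator `V'₁`. -/
def V₁' : Module.End ℂ Aux := transpose V₁

/-- The operator `W'₀`. -/
def W₀' : Module.End ℂ Aux :=
  transpose W₀ - (E 0 0 0 1 1 1 1 1 + E 0 0 0 1 1 2 1 1)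

/-- The operator `W'₁`. -/
def W₁' : Module.End ℂ Aux :=
  transpose W₁
    - (E 0 0 2 1 1 1 1 1 + E 0 0 2 1 1 1 2 1 + E 0 1 2 1 1 2 1 1 + E 0 1 2 1 1 2 2 1)

/-- The operators `V_s`, `s ∈ {0,1}`. -/
def V (s : ZMod 2) : Module.End ℂ Aux := if s = 0 then V₀ else V₁

/-- The operators `W_s`, `s ∈ {0,1}`. -/
def W (s : ZMod 2) : Module.End ℂ Aux := if s = 0 then W₀ else W₁

/-- The operators `V'_s`, `s ∈ {0,1}`. -/
def V' (s : ZMod 2) : Module.End ℂ Aux := if s = 0 then V₀' else V₁'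

/-- The operators `W'_s`, `s ∈ {0,1}`. -/
def W' (s : ZMod 2) : Module.End ℂ Aux := if s = 0 then W₀' else W₁'

/-! ### Boundary vectors and amplitudes -/

/-- `⟨l(t)| = ⟨0,t,0,0|`. -/
def lVec (t : ℕ) : Aux →ₗ[ℂ] ℂ := bra 0 t 0 0

/-- `|r⟩ = |0,0,0,1⟩ + |0,0,1,1⟩ + |0,0,2,1⟩`. -/
def rVec : Aux := ket 0 0 0 1 + ket 0 0 1 1 + ket 0 0 2 1

/-- `⟨l'| = ⟨0,0,0,1| + ⟨0,0,1,1| + ⟨0,0,2,1| + ⟨0,1,0,1| + ⟨0,1,2,1|`. -/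
def lVec' : Aux →ₗ[ℂ] ℂ :=
  bra 0 0 0 1 + bra 0 0 1 1 + bra 0 0 2 1 + bra 0 1 0 1 + bra 0 1 2 1

/-- `|r'(t)⟩ = |0,t+1,0,0⟩`. -/
def rVec' (t : ℕ) : Aux := ket 0 (t + 1) 0 0

/-- The alternating product `A_{s_1} B_{s_2} A_{s_3} B_{s_4} ⋯` along a string `s`. -/
def alternating (A B : ZMod 2 → Module.End ℂ Aux) {r : ℕ} (s : Fin r → ZMod 2) :
    Module.End ℂ Aux :=
  (List.ofFn fun k : Fin r => if Even (k : ℕ) then A (s k) else B (s k)).prod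

/-- The amplitude
`⟨l(t)| V_{s_{-t}} W_{s_{-t+1}} ⋯ V_{s_t} |r⟩ + ⟨l'| V'_{s_{-t}} W'_{s_{-t+1}} ⋯ V'_{s_t} |r'(t)⟩`;
the entry `k` of the string `s` is the state of the site `k - t`. -/
def amplitude (t : ℕ) (s : Fin (2 * t + 1) → ZMod 2) : ℂ :=
  lVec t (alternating V W s rVec) + lVec' (alternating V' W' s (rVec' t))

end Rule54

end

/-! Both terms of the amplitude are sums over paths of a nondeterministic automaton that scans the
string through labels `(c, w, n, a)`. Here `n` is the length, capped at 2, of the run of occupied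
sites just scanned. The bit `a` switches from 0 to 1 at most once, and before the switch each W
lowers `w` by one and raises `c` by one. Composing functionals instead of applying operators turns
the right term into the same kind of scan, run from the right end, with some transitions deleted by
the corrections in `V₀'`, `W₀'`, `W₁'`.

Since U(t) is composition with M_t, induction on time reduces the theorem to a conservation law: for
t ≥ 1, a string of length 2t+3 has the same amplitude as its image of length 2t+1 under one time
step. Each of the two terms satisfies this law separately (`word_evolved`, `word_evolved'`). The
reason is an intertwiner D_s (`shift`, `shift'`) with D_{s₁} W_{s₂} V_{s₃} W_{s₄} = V_χ W_{s₃}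
D_{s₃} W_{s₄}, χ = χ(s₁,s₂,s₃). It is created at the start of the word, moves through it two sites
at a time, leaving updated sites behind, and is absorbed at the end vector.

These relations are finite checks, valid only on part of the labels. The congruence lemmas show that
the scan, started from the boundary label, never reads the others. The two terms are needed together
only at t = 1, where their sum is the indicator of χ = 1 (`word_one`). -/

noncomputable section

namespace Rule54

/-! ### Rows of the operators -/

/-- The row `⟨c,w,n,a| V₀`, paired with a family indexed by the labels. -/
def rowV₀ {M : Type*} [AddCommMonoid M] (f : ℕ → ℕ → Fin 3 → Fin 2 → M) :
    ℕ → ℕ → Fin 3 → Fin 2 → M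
  | c, w, 0, 0 => f c w 0 0
  | 0, w, 1, 0 => f 0 w 0 0
  | c + 1, w, 1, 0 => f (c + 1) w 0 0 + f c w 0 1
  | c, w, 2, 0 => f c w 0 0
  | 0, 0, 0, 1 => f 0 0 0 1
  | _ + 1, 0, 0, 1 => 0
  | c, w + 1, 0, 1 => f c (w + 1) 0 1
  | 0, 0, 1, 1 => f 0 0 0 1
  | 0, _ + 1, 1, 1 => 0
  | _ + 1, 0, 1, 1 => 0
  | c + 1, w + 1, 1, 1 => f c w 0 1
  | 0, 0, 2, 1 => f 0 0 0 1
  | _ + 1, 0, 2, 1 => 0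
  | c, w + 1, 2, 1 => f c (w + 1) 0 1

/-- The row `⟨c,w,n,a| V₁`, paired with a family indexed by the labels. -/
def rowV₁ {M : Type*} [AddCommMonoid M] (f : ℕ → ℕ → Fin 3 → Fin 2 → M) :
    ℕ → ℕ → Fin 3 → Fin 2 → M
  | c, w, 0, 0 => f c w 1 0
  | c, w, 1, 0 => f c w 2 0 + f c w 2 1
  | c, w, 2, 0 => f c w 2 0 + f c w 2 1
  | 0, 0, 0, 1 => f 0 0 1 1
  | _ + 1, 0, 0, 1 => 0
  | c, w + 1, 0, 1 => f c (w + 1) 1 1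
  | 0, 0, 1, 1 => f 0 0 2 1
  | _ + 1, 0, 1, 1 => 0
  | c, w + 1, 1, 1 => f c w 2 1
  | 0, 0, 2, 1 => f 0 0 2 1
  | _ + 1, 0, 2, 1 => 0
  | c, w + 1, 2, 1 => f c w 2 1

/-- The row `⟨c,w,n,a| W₀`, paired with a family indexed by the labels. -/
def rowW₀ {M : Type*} [AddCommMonoid M] (f : ℕ → ℕ → Fin 3 → Fin 2 → M) :
    ℕ → ℕ → Fin 3 → Fin 2 → M
  | _, 0, 0, 0 => 0
  | c, w + 1, 0, 0 => f (c + 1) w 0 0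
  | _, 0, 1, 0 => 0
  | c, w + 1, 1, 0 => f (c + 1) w 0 0 + f c w 0 1
  | _, 0, 2, 0 => 0
  | c, w + 1, 2, 0 => f (c + 1) w 0 0
  | 0, 0, 0, 1 => f 0 0 0 1
  | _ + 1, 0, 0, 1 => 0
  | c, w + 1, 0, 1 => f c w 0 1
  | 0, 0, 1, 1 => f 0 0 0 1
  | 0, _ + 1, 1, 1 => 0
  | _ + 1, 0, 1, 1 => 0
  | 1, 1, 1, 1 => f 0 0 0 1
  | _ + 2, 1, 1, 1 => 0
  | c + 1, w + 2, 1, 1 => f c w 0 1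
  | 0, 0, 2, 1 => f 0 0 0 1
  | _ + 1, 0, 2, 1 => 0
  | c, w + 1, 2, 1 => f c w 0 1

/-- The row `⟨c,w,n,a| W₁`, paired with a family indexed by the labels. -/
def rowW₁ {M : Type*} [AddCommMonoid M] (f : ℕ → ℕ → Fin 3 → Fin 2 → M) :
    ℕ → ℕ → Fin 3 → Fin 2 → M
  | _, 0, 0, 0 => 0
  | c, w + 1, 0, 0 => f (c + 1) w 1 0
  | _, 0, 1, 0 => 0
  | c, w + 1, 1, 0 => f (c + 1) w 2 0
  | _, 0, 2, 0 => 0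
  | c, w + 1, 2, 0 => f (c + 1) w 2 0
  | 0, 0, 0, 1 => f 0 0 1 1
  | _ + 1, 0, 0, 1 => 0
  | c, w + 1, 0, 1 => f c w 1 1
  | 0, 0, 1, 1 => f 0 0 2 1
  | 0, _ + 1, 1, 1 => 0
  | _ + 1, 0, 1, 1 => 0
  | c + 1, w + 1, 1, 1 => f c w 2 1
  | 0, 0, 2, 1 => f 0 0 2 1
  | 0, _ + 1, 2, 1 => 0
  | _ + 1, 0, 2, 1 => 0
  | c + 1, w + 1, 2, 1 => f c w 2 1

/-- The column of `V₀'` at the label `(c,w,n,a)`. -/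
def rowV₀' {M : Type*} [AddCommMonoid M] (f : ℕ → ℕ → Fin 3 → Fin 2 → M)
    (c w : ℕ) (n : Fin 3) (a : Fin 2) : M :=
  if c = 1 ∧ w = 1 ∧ n = 1 ∧ a = 1 then 0
  else if c = 1 ∧ w = 2 ∧ n = 1 ∧ a = 1 then 0
  else if c = 1 ∧ w = 1 ∧ n = 1 ∧ a = 0 then f 1 1 0 0
  else rowV₀ f c w n a

/-- The column of `W₀'` at the label `(c,w,n,a)`. -/
def rowW₀' {M : Type*} [AddCommMonoid M] (f : ℕ → ℕ → Fin 3 → Fin 2 → M)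
    (c w : ℕ) (n : Fin 3) (a : Fin 2) : M :=
  if c = 1 ∧ (w = 1 ∨ w = 2) ∧ n = 1 ∧ a = 1 then 0 else rowW₀ f c w n a

/-- The column of `W₁'` at the label `(c,w,n,a)`. -/
def rowW₁' {M : Type*} [AddCommMonoid M] (f : ℕ → ℕ → Fin 3 → Fin 2 → M)
    (c w : ℕ) (n : Fin 3) (a : Fin 2) : M :=
  if c = 1 ∧ (w = 1 ∨ w = 2) ∧ (n = 1 ∨ n = 2) ∧ a = 1 then 0 else rowW₁ f c w n a

/-! ### Entries of the elementary operators -/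

/-- The coordinates of a vector, as a function of the four labels. -/
def coord (x : Aux) (c w : ℕ) (n : Fin 3) (a : Fin 2) : ℂ := x (c, w, n, a)

/-- Exhibiting the row as a vector `y` supplies the finiteness that `transpose` tests for, so its
default value 0 never enters. -/
theorem transpose_single {A : Module.End ℂ Aux} {i : Label} {y : Aux}
    (h : ∀ j : Label, A (Finsupp.single j 1) i = y j) :
    transpose A (Finsupp.single i 1) = y := by
  have hfun : (fun j : Label => A (Finsupp.single j 1) i) = y := funext h
  have hfin : (Function.support fun j : Label => A (Finsupp.single j 1) i).Finite := by
    rw [hfun]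
    exact y.hasFiniteSupport
  rw [transpose, Finsupp.linearCombination_single, one_smul, dif_pos hfin]
  ext j
  exact h j

theorem ofBasis_ket (v : ℕ → ℕ → Fin 3 → Fin 2 → Aux) (c w : ℕ) (n : Fin 3) (a : Fin 2) :
    ofBasis v (ket c w n a) = v c w n a := by
  simp [ofBasis, ket]

theorem coord_ket (c w : ℕ) (n : Fin 3) (a : Fin 2) (c' w' : ℕ) (n' : Fin 3) (a' : Fin 2) :
    coord (ket c w n a) c' w' n' a' = if c = c' ∧ w = w' ∧ n = n' ∧ a = a' then 1 else 0 := by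
  simp [coord, ket, Finsupp.single_apply]

theorem bra_ket (c w : ℕ) (n : Fin 3) (a : Fin 2) (c' w' : ℕ) (n' : Fin 3) (a' : Fin 2) :
    bra c' w' n' a' (ket c w n a) = if c = c' ∧ w = w' ∧ n = n' ∧ a = a' then 1 else 0 :=
  coord_ket c w n a c' w' n' a'

/-- A linear functional on the auxiliary space is determined by its values on the kets. -/
theorem functional_ext {φ ψ : Aux →ₗ[ℂ] ℂ}
    (h : ∀ c w n a, φ (ket c w n a) = ψ (ket c w n a)) (x : Aux) : φ x = ψ x := by
  have : φ = ψ := by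
    refine Finsupp.lhom_ext' fun i => ?_
    ext
    obtain ⟨c, w, n, a⟩ := i
    exact h c w n a
  rw [this]

/-- An entry of an operator, as a linear functional of its argument. -/
def entry (A : Module.End ℂ Aux) (c w : ℕ) (n : Fin 3) (a : Fin 2) : Aux →ₗ[ℂ] ℂ :=
  bra c w n a ∘ₗ A

theorem coord_e (n₂ : Fin 3) (a₂ : Fin 2) (n₁ : Fin 3) (a₁ : Fin 2) (x : Aux)
    (c w : ℕ) (n : Fin 3) (a : Fin 2) :
    coord (e n₂ a₂ n₁ a₁ x) c w n a = if n = n₂ ∧ a = a₂ then coord x c w n₁ a₁ else 0 := by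
  refine functional_ext (φ := entry (e n₂ a₂ n₁ a₁) c w n a)
    (ψ := if n = n₂ ∧ a = a₂ then bra c w n₁ a₁ else 0) (fun c' w' n' a' => ?_) x |>.trans ?_
  · simp only [entry, e, LinearMap.comp_apply, ofBasis_ket]
    change coord _ c w n a = _
    split_ifs <;> simp_all [bra, ket, coord, Finsupp.single_apply]
  · split_ifs <;> rfl

theorem coord_E (c₂ w₂ : ℕ) (n₂ : Fin 3) (a₂ : Fin 2) (c₁ w₁ : ℕ) (n₁ : Fin 3) (a₁ : Fin 2)
    (x : Aux) (c w : ℕ) (n : Fin 3) (a : Fin 2) :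
    coord (E c₂ w₂ n₂ a₂ c₁ w₁ n₁ a₁ x) c w n a =
      if c = c₂ ∧ w = w₂ ∧ n = n₂ ∧ a = a₂ then coord x c₁ w₁ n₁ a₁ else 0 := by
  simp only [E, coord, bra, ket, LinearMap.smulRight_apply, Finsupp.lapply_apply,
    Finsupp.smul_apply, Finsupp.single_apply, smul_eq_mul, mul_ite, mul_one, mul_zero,
    Prod.mk.injEq]
  grind

theorem coord_cUp_zero (x : Aux) (w : ℕ) (n : Fin 3) (a : Fin 2) :
    coord (cUp x) 0 w n a = 0 := by
  refine functional_ext (φ := entry cUp 0 w n a) (ψ := 0) (fun c' w' n' a' => ?_) x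
  simp [entry, cUp, ofBasis_ket, bra_ket]

theorem coord_cUp_succ (x : Aux) (c w : ℕ) (n : Fin 3) (a : Fin 2) :
    coord (cUp x) (c + 1) w n a = coord x c w n a := by
  refine functional_ext (φ := entry cUp (c + 1) w n a) (ψ := bra c w n a)
    (fun c' w' n' a' => ?_) x
  simp [entry, cUp, ofBasis_ket, bra_ket]

theorem coord_wUp_zero (x : Aux) (c : ℕ) (n : Fin 3) (a : Fin 2) :
    coord (wUp x) c 0 n a = 0 := by
  refine functional_ext (φ := entry wUp c 0 n a) (ψ := 0) (fun c' w' n' a' => ?_) x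
  simp [entry, wUp, ofBasis_ket, bra_ket]

theorem coord_wUp_succ (x : Aux) (c w : ℕ) (n : Fin 3) (a : Fin 2) :
    coord (wUp x) c (w + 1) n a = coord x c w n a := by
  refine functional_ext (φ := entry wUp c (w + 1) n a) (ψ := bra c w n a)
    (fun c' w' n' a' => ?_) x
  simp [entry, wUp, ofBasis_ket, bra_ket]

theorem cDown_ket_zero (w : ℕ) (n : Fin 3) (a : Fin 2) : cDown (ket 0 w n a) = 0 :=
  transpose_single fun _ => coord_cUp_zero _ w n a

theorem cDown_ket_succ (c w : ℕ) (n : Fin 3) (a : Fin 2) :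
    cDown (ket (c + 1) w n a) = ket c w n a :=
  transpose_single fun _ => (coord_cUp_succ _ c w n a).trans <| by
    simp [coord, ket, Finsupp.single_apply, eq_comm]

theorem wDown_ket_zero (c : ℕ) (n : Fin 3) (a : Fin 2) : wDown (ket c 0 n a) = 0 :=
  transpose_single fun _ => coord_wUp_zero _ c n a

theorem wDown_ket_succ (c w : ℕ) (n : Fin 3) (a : Fin 2) :
    wDown (ket c (w + 1) n a) = ket c w n a :=
  transpose_single fun _ => (coord_wUp_succ _ c w n a).trans <| by
    simp [coord, ket, Finsupp.single_apply, eq_comm]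

theorem coord_cDown (x : Aux) (c w : ℕ) (n : Fin 3) (a : Fin 2) :
    coord (cDown x) c w n a = coord x (c + 1) w n a := by
  refine functional_ext (φ := entry cDown c w n a) (ψ := bra (c + 1) w n a)
    (fun c' w' n' a' => ?_) x
  cases c' <;>
    simp [entry, cDown_ket_zero, cDown_ket_succ, bra_ket]

theorem coord_wDown (x : Aux) (c w : ℕ) (n : Fin 3) (a : Fin 2) :
    coord (wDown x) c w n a = coord x c (w + 1) n a := by
  refine functional_ext (φ := entry wDown c w n a) (ψ := bra c (w + 1) n a)
    (fun c' w' n' a' => ?_) x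
  cases w' <;>
    simp [entry, wDown_ket_zero, wDown_ket_succ, bra_ket]

theorem coord_add (x y : Aux) (c w : ℕ) (n : Fin 3) (a : Fin 2) :
    coord (x + y) c w n a = coord x c w n a + coord y c w n a := rfl

/-! ### Rows of the matrices of the ansatz -/

theorem coord_V₀ (x : Aux) (c w : ℕ) (n : Fin 3) (a : Fin 2) :
    coord (V₀ x) c w n a = rowV₀ (coord x) c w n a := by
  fin_cases n <;> fin_cases a <;> rcases c with _ | c <;> rcases w with _ | w <;>
    simp [V₀, rowV₀, coord_add, coord_e, coord_E, coord_cUp_zero, coord_cUp_succ,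
      coord_wUp_zero, coord_wUp_succ, coord_wDown]

theorem coord_V₁ (x : Aux) (c w : ℕ) (n : Fin 3) (a : Fin 2) :
    coord (V₁ x) c w n a = rowV₁ (coord x) c w n a := by
  fin_cases n <;> fin_cases a <;> rcases c with _ | c <;> rcases w with _ | w <;>
    simp [V₁, rowV₁, coord_add, coord_e, coord_E,
      coord_wUp_zero, coord_wUp_succ, coord_wDown]

theorem coord_W₀ (x : Aux) (c w : ℕ) (n : Fin 3) (a : Fin 2) :
    coord (W₀ x) c w n a = rowW₀ (coord x) c w n a := by
  fin_cases n <;> fin_cases a <;> rcases c with _ | _ | c <;> rcases w with _ | _ | w <;>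
    simp [W₀, rowW₀, coord_add, coord_e, coord_E, coord_cUp_zero, coord_cUp_succ, pow_two,
      coord_wUp_zero, coord_wUp_succ, coord_cDown]

theorem coord_W₁ (x : Aux) (c w : ℕ) (n : Fin 3) (a : Fin 2) :
    coord (W₁ x) c w n a = rowW₁ (coord x) c w n a := by
  fin_cases n <;> fin_cases a <;> rcases c with _ | c <;> rcases w with _ | w <;>
    simp [W₁, rowW₁, coord_add, coord_e, coord_E, coord_cUp_zero, coord_cUp_succ,
      coord_wUp_zero, coord_wUp_succ, coord_cDown]

/-! ### Columns of the transposed operators -/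

/-- A row operation only adds entries, so it commutes with linear maps. This links its two uses: on
coordinates in ℂ it is the action of `V₀`, and on the family `ket` it gives the columns of the
transpose. -/
theorem map_rowV₀ (φ : Aux →ₗ[ℂ] ℂ) (f : ℕ → ℕ → Fin 3 → Fin 2 → Aux) (c w : ℕ) (n : Fin 3)
    (a : Fin 2) :
    φ (rowV₀ f c w n a) = rowV₀ (fun c w n a => φ (f c w n a)) c w n a := by
  fin_cases n <;> fin_cases a <;> rcases c with _ | c <;> rcases w with _ | w <;> simp [rowV₀]

theorem map_rowV₁ (φ : Aux →ₗ[ℂ] ℂ) (f : ℕ → ℕ → Fin 3 → Fin 2 → Aux) (c w : ℕ) (n : Fin 3)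
    (a : Fin 2) :
    φ (rowV₁ f c w n a) = rowV₁ (fun c w n a => φ (f c w n a)) c w n a := by
  fin_cases n <;> fin_cases a <;> rcases c with _ | c <;> rcases w with _ | w <;> simp [rowV₁]

theorem map_rowW₀ (φ : Aux →ₗ[ℂ] ℂ) (f : ℕ → ℕ → Fin 3 → Fin 2 → Aux) (c w : ℕ) (n : Fin 3)
    (a : Fin 2) :
    φ (rowW₀ f c w n a) = rowW₀ (fun c w n a => φ (f c w n a)) c w n a := by
  fin_cases n <;> fin_cases a <;> rcases c with _ | _ | c <;> rcases w with _ | _ | w <;>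
    simp [rowW₀]

theorem map_rowW₁ (φ : Aux →ₗ[ℂ] ℂ) (f : ℕ → ℕ → Fin 3 → Fin 2 → Aux) (c w : ℕ) (n : Fin 3)
    (a : Fin 2) :
    φ (rowW₁ f c w n a) = rowW₁ (fun c w n a => φ (f c w n a)) c w n a := by
  fin_cases n <;> fin_cases a <;> rcases c with _ | c <;> rcases w with _ | w <;> simp [rowW₁]

/-- The matrix of the identity operator is symmetric. -/
theorem coord_single (j : Label) :
    coord (Finsupp.single j 1) = fun c w n a => bra j.1 j.2.1 j.2.2.1 j.2.2.2 (ket c w n a) := by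
  funext c w n a
  simp [coord, bra, ket, Finsupp.single_apply, eq_comm]

theorem transpose_V₀_ket (c w : ℕ) (n : Fin 3) (a : Fin 2) :
    transpose V₀ (ket c w n a) = rowV₀ ket c w n a :=
  transpose_single fun j => (coord_V₀ _ c w n a).trans <| by
    rw [coord_single, ← map_rowV₀]
    rfl

theorem transpose_V₁_ket (c w : ℕ) (n : Fin 3) (a : Fin 2) :
    transpose V₁ (ket c w n a) = rowV₁ ket c w n a :=
  transpose_single fun j => (coord_V₁ _ c w n a).trans <| by
    rw [coord_single, ← map_rowV₁]
    rfl

theorem transpose_W₀_ket (c w : ℕ) (n : Fin 3) (a : Fin 2) :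
    transpose W₀ (ket c w n a) = rowW₀ ket c w n a :=
  transpose_single fun j => (coord_W₀ _ c w n a).trans <| by
    rw [coord_single, ← map_rowW₀]
    rfl

theorem transpose_W₁_ket (c w : ℕ) (n : Fin 3) (a : Fin 2) :
    transpose W₁ (ket c w n a) = rowW₁ ket c w n a :=
  transpose_single fun j => (coord_W₁ _ c w n a).trans <| by
    rw [coord_single, ← map_rowW₁]
    rfl

theorem E_ket (c₂ w₂ : ℕ) (n₂ : Fin 3) (a₂ : Fin 2) (c₁ w₁ : ℕ) (n₁ : Fin 3) (a₁ : Fin 2)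
    (c w : ℕ) (n : Fin 3) (a : Fin 2) :
    E c₂ w₂ n₂ a₂ c₁ w₁ n₁ a₁ (ket c w n a) =
      if c = c₁ ∧ w = w₁ ∧ n = n₁ ∧ a = a₁ then ket c₂ w₂ n₂ a₂ else 0 := by
  simp [E, bra_ket]

/-- Each subtracted elementary operator cancels exactly one term of a row of `V₀`, so the correction
amounts to deleting three transitions. -/
theorem map_V₀'_ket (φ : Aux →ₗ[ℂ] ℂ) (c w : ℕ) (n : Fin 3) (a : Fin 2) :
    φ (V₀' (ket c w n a)) = rowV₀' (fun c w n a => φ (ket c w n a)) c w n a := by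
  rw [V₀', LinearMap.sub_apply, transpose_V₀_ket, map_sub, map_rowV₀]
  simp only [LinearMap.add_apply, E_ket, rowV₀']
  fin_cases n <;> fin_cases a <;> rcases c with _ | _ | c <;> rcases w with _ | _ | _ | w <;>
    simp [rowV₀]

theorem map_V₁'_ket (φ : Aux →ₗ[ℂ] ℂ) (c w : ℕ) (n : Fin 3) (a : Fin 2) :
    φ (V₁' (ket c w n a)) = rowV₁ (fun c w n a => φ (ket c w n a)) c w n a := by
  rw [V₁', transpose_V₁_ket, map_rowV₁]

theorem map_W₀'_ket (φ : Aux →ₗ[ℂ] ℂ) (c w : ℕ) (n : Fin 3) (a : Fin 2) :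
    φ (W₀' (ket c w n a)) = rowW₀' (fun c w n a => φ (ket c w n a)) c w n a := by
  rw [W₀', LinearMap.sub_apply, transpose_W₀_ket, map_sub, map_rowW₀]
  simp only [LinearMap.add_apply, E_ket, rowW₀']
  fin_cases n <;> fin_cases a <;> rcases c with _ | _ | c <;> rcases w with _ | _ | _ | w <;>
    simp [rowW₀]

theorem map_W₁'_ket (φ : Aux →ₗ[ℂ] ℂ) (c w : ℕ) (n : Fin 3) (a : Fin 2) :
    φ (W₁' (ket c w n a)) = rowW₁' (fun c w n a => φ (ket c w n a)) c w n a := by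
  rw [W₁', LinearMap.sub_apply, transpose_W₁_ket, map_sub, map_rowW₁]
  simp only [LinearMap.add_apply, E_ket, rowW₁']
  fin_cases n <;> fin_cases a <;> rcases c with _ | _ | c <;> rcases w with _ | _ | _ | w <;>
    simp [rowW₁]

/-! ### Exchange relations -/

/-- Families of amplitudes indexed by the labels of the auxiliary space. -/
abbrev Family : Type := ℕ → ℕ → Fin 3 → Fin 2 → ℂ

/-- The action of `V_s` on families. -/
def rowV (s : ZMod 2) (f : Family) : Family := if s = 0 then rowV₀ f else rowV₁ f

/-- The action of `W_s` on families. -/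
def rowW (s : ZMod 2) (f : Family) : Family := if s = 0 then rowW₀ f else rowW₁ f

/-- The action of the transpose of `V'_s` on families. -/
def rowV' (s : ZMod 2) (f : Family) : Family := if s = 0 then rowV₀' f else rowV₁ f

/-- The action of the transpose of `W'_s` on families. -/
def rowW' (s : ZMod 2) (f : Family) : Family := if s = 0 then rowW₀' f else rowW₁' f

/-- The intertwiner after a site in the state `0`. -/
def shift₀ (f : Family) : Family
  | c, w, 0, a => f c (w + 1) 0 a
  | _, _, 1, _ => 0
  | _, _, 2, _ => 0

/-- The intertwiner after a site in the state `1`. -/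
def shift₁ (f : Family) : Family
  | _, _, 0, _ => 0
  | c, w, 1, 0 => f c (w + 1) 2 0 + f c (w + 1) 2 1
  | c, w, 2, 0 => f c (w + 1) 1 0
  | c, w, 1, 1 => f c w 2 1
  | c, w, 2, 1 => f (c + 1) (w + 1) 1 1

/-- The intertwiner of the transposed operators after a site in the state `1`. -/
def shift₁' (f : Family) : Family
  | _, _, 0, _ => 0
  | c, w, 1, 0 => f c (w + 1) 2 0 + f c (w + 1) 2 1
  | c, w, 2, 0 => f c (w + 1) 1 0
  | c, w, 1, 1 => f c w 2 1
  | 0, 0, 2, 1 => f 0 0 1 1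
  | c + 1, 0, 2, 1 => f (c + 2) 1 1 1
  | c, w + 1, 2, 1 => f (c + 1) (w + 2) 1 1

/-- The intertwiner between the products for consecutive times. -/
def shift (s : ZMod 2) (f : Family) : Family := if s = 0 then shift₀ f else shift₁ f

/-- The intertwiner between the transposed products for consecutive times. -/
def shift' (s : ZMod 2) (f : Family) : Family := if s = 0 then shift₀ f else shift₁' f

theorem zmod_two_cases (s : ZMod 2) : s = 0 ∨ s = 1 := by
  revert s
  decide

theorem chi_values : chi 0 0 0 = 0 ∧ chi 0 0 1 = 1 ∧ chi 0 1 0 = 1 ∧ chi 0 1 1 = 0 ∧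
    chi 1 0 0 = 1 ∧ chi 1 0 1 = 1 ∧ chi 1 1 0 = 0 ∧ chi 1 1 1 = 0 := by
  decide

set_option maxHeartbeats 2000000 in
-- The bulk step of the conservation law. The site `s₃` survives the update and is also the left
-- neighbour of the next updated site, so the intertwiner must remember it. The hypothesis `hn` is
-- needed because `shift s₁` vanishes on every `n` incompatible with the last scanned site.
theorem shift_exchange (f : Family) (s₁ s₂ s₃ s₄ : ZMod 2) (c w : ℕ) (n : Fin 3) (a : Fin 2)
    (hn : n = 0 ↔ s₁ = 0) (ha : a = 0 → c + w ≠ 0) :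
    shift s₁ (rowW s₂ (rowV s₃ (rowW s₄ f))) c w n a =
      rowV (chi s₁ s₂ s₃) (rowW s₃ (shift s₃ (rowW s₄ f))) c w n a := by
  obtain ⟨h₁, h₂, h₃, h₄, h₅, h₆, h₇, h₈⟩ := chi_values
  rcases zmod_two_cases s₁ with rfl | rfl <;> fin_cases n <;> simp at hn <;>
  fin_cases a <;>
  rcases zmod_two_cases s₂ with rfl | rfl <;> rcases zmod_two_cases s₃ with rfl | rfl <;>
  rcases zmod_two_cases s₄ with rfl | rfl <;>
  simp only [h₁, h₂, h₃, h₄, h₅, h₆, h₇, h₈, rowV, rowW, shift, one_ne_zero, if_true, if_false] <;>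
  -- The row operations branch only on small `c` and `w`; splitting this deep makes all the nested
  -- pattern matches reduce.
  rcases c with _ | _ | _ | c <;> rcases w with _ | _ | _ | _ | _ | w <;>
  simp [rowV₀, rowV₁, rowW₀, rowW₁, shift₀, shift₁] at ha ⊢

set_option maxHeartbeats 2000000 in
-- The relation breaks down at `(0, 1, 2, 1)`, the label excluded by `hl`: there the left side is
-- killed by the deletion at `(1, 2, 1, 1)`, while the right side need not vanish.
theorem shift'_exchange (f : Family) (s₁ s₂ s₃ s₄ : ZMod 2) (c w : ℕ) (n : Fin 3) (a : Fin 2)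
    (hn : n = 0 ↔ s₁ = 0) (ha : a = 0 → w ≠ 0 ∧ 2 ≤ c + w)
    (hl : ¬ (c = 0 ∧ w = 1 ∧ n = 2 ∧ a = 1)) :
    shift' s₁ (rowW' s₂ (rowV' s₃ (rowW' s₄ f))) c w n a =
      rowV' (chi s₁ s₂ s₃) (rowW' s₃ (shift' s₃ (rowW' s₄ f))) c w n a := by
  obtain ⟨h₁, h₂, h₃, h₄, h₅, h₆, h₇, h₈⟩ := chi_values
  rcases zmod_two_cases s₁ with rfl | rfl <;> fin_cases n <;> simp at hn <;>
  fin_cases a <;>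
  rcases zmod_two_cases s₂ with rfl | rfl <;> rcases zmod_two_cases s₃ with rfl | rfl <;>
  rcases zmod_two_cases s₄ with rfl | rfl <;>
  simp only [h₁, h₂, h₃, h₄, h₅, h₆, h₇, h₈, rowV', rowW', shift', one_ne_zero, if_true,
    if_false] <;>
  rcases c with _ | _ | _ | c <;> rcases w with _ | _ | _ | _ | _ | w <;>
  simp [rowV₀, rowV₁, rowW₀, rowW₁, shift₀, shift₁', rowV₀', rowW₀', rowW₁'] at ha hl ⊢

/-! ### Boundary relations -/

/-- The family of the coordinates of `|r⟩`. -/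
def endFamily : Family := fun c w _ a => if c = 0 ∧ w = 0 ∧ a = 1 then 1 else 0

/-- The family of the coordinates of `⟨l'|`. -/
def endFamily' : Family := fun c w n a =>
  if c = 0 ∧ (w = 0 ∨ w = 1 ∧ n ≠ 1) ∧ a = 1 then 1 else 0

/-- Absorption of the intertwiner by the end vector, which uses up the last two sites of the longer
string. -/
theorem shift_end (s₁ s₂ s₃ : ZMod 2) (c w : ℕ) (n : Fin 3) (a : Fin 2)
    (hn : n = 0 ↔ s₁ = 0) (hw : w = 0) (ha : a = 0 → c ≠ 0) :
    shift s₁ (rowW s₂ (rowV s₃ endFamily)) c w n a = rowV (chi s₁ s₂ s₃) endFamily c w n a := by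
  obtain ⟨h₁, h₂, h₃, h₄, h₅, h₆, h₇, h₈⟩ := chi_values
  subst hw
  rcases zmod_two_cases s₁ with rfl | rfl <;> fin_cases n <;> simp at hn <;>
  fin_cases a <;>
  rcases zmod_two_cases s₂ with rfl | rfl <;> rcases zmod_two_cases s₃ with rfl | rfl <;>
  simp only [h₁, h₂, h₃, h₄, h₅, h₆, h₇, h₈, rowV, rowW, shift, one_ne_zero, if_true, if_false] <;>
  rcases c with _ | _ | _ | c <;>
  simp [rowV₀, rowV₁, rowW₀, rowW₁, shift₀, shift₁, endFamily] at ha ⊢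

/-- Here `w` may still be 1, because |r'(t)⟩ starts with one unit of `w` more than there are W's;
the components of ⟨l'| with w = 1 account for it. -/
theorem shift'_end (s₁ s₂ s₃ : ZMod 2) (c w : ℕ) (n : Fin 3) (a : Fin 2)
    (hn : n = 0 ↔ s₁ = 0) (hw : w ≤ 1) (ha : a = 0 → w = 1 ∧ c ≠ 0)
    (hl : ¬ (c = 0 ∧ w = 1 ∧ n = 2 ∧ a = 1)) :
    shift' s₁ (rowW' s₂ (rowV' s₃ endFamily')) c w n a =
      rowV' (chi s₁ s₂ s₃) endFamily' c w n a := by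
  obtain ⟨h₁, h₂, h₃, h₄, h₅, h₆, h₇, h₈⟩ := chi_values
  rcases zmod_two_cases s₁ with rfl | rfl <;> fin_cases n <;> simp at hn <;>
  fin_cases a <;>
  rcases zmod_two_cases s₂ with rfl | rfl <;> rcases zmod_two_cases s₃ with rfl | rfl <;>
  simp only [h₁, h₂, h₃, h₄, h₅, h₆, h₇, h₈, rowV', rowW', shift', one_ne_zero, if_true,
    if_false] <;>
  rcases c with _ | _ | _ | c <;> rcases w with _ | _ | w <;>
  simp [rowV₀, rowV₁, rowW₀, rowW₁, shift₀, shift₁', rowV₀', rowW₀', rowW₁', endFamily']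
    at ha hl hw ⊢

/-- Creation of the intertwiner at the boundary label. The drop of `w` by one matches the shorter
word, which contains one W fewer. -/
theorem shift_start (f : Family) (m : ℕ) (s₁ s₂ s₃ s₄ : ZMod 2) :
    rowV s₁ (rowW s₂ (rowV s₃ (rowW s₄ f))) 0 (m + 2) 0 0 =
      rowV (chi s₁ s₂ s₃) (rowW s₃ (shift s₃ (rowW s₄ f))) 0 (m + 1) 0 0 := by
  obtain ⟨h₁, h₂, h₃, h₄, h₅, h₆, h₇, h₈⟩ := chi_values
  rcases zmod_two_cases s₁ with rfl | rfl <;> rcases zmod_two_cases s₂ with rfl | rfl <;>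
  rcases zmod_two_cases s₃ with rfl | rfl <;> rcases zmod_two_cases s₄ with rfl | rfl <;>
  simp only [h₁, h₂, h₃, h₄, h₅, h₆, h₇, h₈, rowV, rowW, shift, one_ne_zero, if_true, if_false] <;>
  rcases m with _ | _ | m <;>
  simp [rowV₀, rowV₁, rowW₀, rowW₁, shift₀, shift₁]

theorem shift'_start (f : Family) (m : ℕ) (s₁ s₂ s₃ s₄ : ZMod 2) :
    rowV' s₁ (rowW' s₂ (rowV' s₃ (rowW' s₄ f))) 0 (m + 3) 0 0 =
      rowV' (chi s₁ s₂ s₃) (rowW' s₃ (shift' s₃ (rowW' s₄ f))) 0 (m + 2) 0 0 := by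
  obtain ⟨h₁, h₂, h₃, h₄, h₅, h₆, h₇, h₈⟩ := chi_values
  rcases zmod_two_cases s₁ with rfl | rfl <;> rcases zmod_two_cases s₂ with rfl | rfl <;>
  rcases zmod_two_cases s₃ with rfl | rfl <;> rcases zmod_two_cases s₄ with rfl | rfl <;>
  simp only [h₁, h₂, h₃, h₄, h₅, h₆, h₇, h₈, rowV', rowW', shift', one_ne_zero, if_true,
    if_false] <;>
  rcases m with _ | _ | m <;>
  simp [rowV₀, rowV₁, rowW₀, rowW₁, shift₀, shift₁', rowV₀', rowW₀', rowW₁']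

/-! ### Accessible labels -/

theorem rowV_congr {f g : Family} {m : ℕ} (s : ZMod 2)
    (h : ∀ c w n a, w ≤ m → (a = 0 → w = m) → f c w n a = g c w n a)
    (c w : ℕ) (n : Fin 3) (a : Fin 2) (hw : w ≤ m) (ha : a = 0 → w = m) :
    rowV s f c w n a = rowV s g c w n a := by
  rcases zmod_two_cases s with rfl | rfl <;> fin_cases n <;> fin_cases a <;>
  rcases c with _ | c <;> rcases w with _ | w <;>
  simp [rowV, rowV₀, rowV₁] at ha ⊢ <;> grind

/-- Every transition of `W_s` ends at an `n` compatible with `s`, and those that keep a = 0 raise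
`c`. This yields the hypotheses under which the intertwiner relations hold. -/
theorem rowW_congr {f g : Family} {m : ℕ} (s : ZMod 2)
    (h : ∀ c w n a, (n = 0 ↔ s = 0) → w ≤ m → (a = 0 → w = m ∧ c ≠ 0) → f c w n a = g c w n a)
    (c w : ℕ) (n : Fin 3) (a : Fin 2) (hw : w ≤ m + 1) (ha : a = 0 → w = m + 1) :
    rowW s f c w n a = rowW s g c w n a := by
  rcases zmod_two_cases s with rfl | rfl <;> fin_cases n <;> fin_cases a <;>
  rcases c with _ | _ | c <;> rcases w with _ | _ | w <;>
  simp [rowW, rowW₀, rowW₁] at ha ⊢ <;> grind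

theorem rowV'_congr {f g : Family} {m : ℕ} (s : ZMod 2)
    (h : ∀ c w n a, w ≤ m → (a = 0 → w = m) → f c w n a = g c w n a)
    (c w : ℕ) (n : Fin 3) (a : Fin 2) (hw : w ≤ m) (ha : a = 0 → w = m) :
    rowV' s f c w n a = rowV' s g c w n a := by
  have key := rowV_congr s h c w n a hw ha
  rcases zmod_two_cases s with rfl | rfl
  · simp only [rowV, rowV', if_true, rowV₀'] at key ⊢
    split_ifs with h₁ h₂ h₃
    · rfl
    · rfl
    · obtain ⟨rfl, rfl, rfl, rfl⟩ := h₃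
      exact h 1 1 0 0 hw ha
    · exact key
  · exact key

set_option maxHeartbeats 2000000 in
-- The label `(0, 1, 2, 1)` could be reached only from `(1, 2, 1, 1)` and `(1, 2, 2, 1)` under `W₁`,
-- and the corrections in `W₁'` delete both transitions.
theorem rowW'_congr {f g : Family} {m : ℕ} (s : ZMod 2)
    (h : ∀ c w n a, (n = 0 ↔ s = 0) → w ≤ m → (a = 0 → w = m ∧ c ≠ 0) →
      ¬ (c = 0 ∧ w = 1 ∧ n = 2 ∧ a = 1) → f c w n a = g c w n a)
    (c w : ℕ) (n : Fin 3) (a : Fin 2) (hw : w ≤ m + 1) (ha : a = 0 → w = m + 1) :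
    rowW' s f c w n a = rowW' s g c w n a := by
  rcases zmod_two_cases s with rfl | rfl <;> fin_cases n <;> fin_cases a <;>
  rcases c with _ | _ | c <;> rcases w with _ | _ | _ | w <;>
  simp [rowW', rowW₀', rowW₁', rowW₀, rowW₁] at ha ⊢ <;> grind

/-! ### Conservation of the two amplitudes -/

/-- The alternating product along the first `2m + 1` entries of a string, applied to a family. -/
def word (A B : ZMod 2 → Family → Family) (g : Family) : ℕ → (ℕ → ZMod 2) → Family
  | 0, σ => A (σ 0) g
  | m + 1, σ => A (σ 0) (B (σ 1) (word A B g m fun k => σ (k + 2)))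

/-- The string at the next time; it is shorter by one site at either end. -/
def evolved (σ : ℕ → ZMod 2) (k : ℕ) : ZMod 2 :=
  if Even k then chi (σ k) (σ (k + 1)) (σ (k + 2)) else σ (k + 1)

theorem evolved_zero (σ : ℕ → ZMod 2) : evolved σ 0 = chi (σ 0) (σ 1) (σ 2) := by
  simp [evolved]

theorem evolved_one (σ : ℕ → ZMod 2) : evolved σ 1 = σ 2 := by
  simp [evolved]

theorem evolved_shift (σ : ℕ → ZMod 2) :
    (fun k => evolved σ (k + 2)) = evolved fun k => σ (k + 2) := by
  funext k
  simp [evolved, Nat.even_add, add_right_comm]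

/-- The intertwiner is carried through the whole remaining word: `shift_exchange` moves it two sites
and `shift_end` absorbs it. -/
theorem shift_word (m : ℕ) (σ : ℕ → ZMod 2) (c w : ℕ) (n : Fin 3) (a : Fin 2)
    (hn : n = 0 ↔ σ 0 = 0) (hw : w ≤ m) (ha : a = 0 → w = m ∧ c ≠ 0) :
    shift (σ 0) (rowW (σ 1) (word rowV rowW endFamily m fun k => σ (k + 2))) c w n a =
      word rowV rowW endFamily m (evolved σ) c w n a := by
  induction m generalizing σ c w n a with
  | zero =>
    simp only [word, evolved_zero]
    exact shift_end _ _ _ _ _ _ _ hn (by omega) fun h => (ha h).2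
  | succ m ih =>
    simp only [word, evolved_zero, evolved_one, evolved_shift]
    rw [shift_exchange _ _ _ _ _ _ _ _ _ hn (fun h => by have := ha h; omega)]
    -- The intertwiner now sits behind a V and a W, so the inner families need to agree only at
    -- labels these two read, which are those covered by the induction hypothesis.
    refine rowV_congr (m := m + 1) _ (rowW_congr _ fun c w n a hn hw ha => ?_) _ _ _ _ hw
      fun h => (ha h).1
    exact ih (fun k => σ (k + 2)) c w n a hn hw ha

theorem shift'_word (m : ℕ) (σ : ℕ → ZMod 2) (c w : ℕ) (n : Fin 3) (a : Fin 2)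
    (hn : n = 0 ↔ σ 0 = 0) (hw : w ≤ m + 1) (ha : a = 0 → w = m + 1 ∧ c ≠ 0)
    (hl : ¬ (c = 0 ∧ w = 1 ∧ n = 2 ∧ a = 1)) :
    shift' (σ 0) (rowW' (σ 1) (word rowV' rowW' endFamily' m fun k => σ (k + 2))) c w n a =
      word rowV' rowW' endFamily' m (evolved σ) c w n a := by
  induction m generalizing σ c w n a with
  | zero =>
    simp only [word, evolved_zero]
    exact shift'_end _ _ _ _ _ _ _ hn hw ha hl
  | succ m ih =>
    simp only [word, evolved_zero, evolved_one, evolved_shift]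
    rw [shift'_exchange _ _ _ _ _ _ _ _ _ hn (fun h => by have := ha h; omega) hl]
    refine rowV'_congr (m := m + 2) _ (rowW'_congr _ fun c w n a hn hw ha hl => ?_) _ _ _ _ hw
      fun h => (ha h).1
    exact ih (fun k => σ (k + 2)) c w n a hn hw ha hl

theorem word_evolved (m : ℕ) (σ : ℕ → ZMod 2) :
    word rowV rowW endFamily (m + 2) σ 0 (m + 2) 0 0 =
      word rowV rowW endFamily (m + 1) (evolved σ) 0 (m + 1) 0 0 := by
  simp only [word, evolved_zero, evolved_one, evolved_shift]
  rw [shift_start]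
  refine rowV_congr (m := m + 1) _ (rowW_congr _ fun c w n a hn hw ha => ?_) _ _ _ _ le_rfl
    fun _ => rfl
  exact shift_word m (fun k => σ (k + 2)) c w n a hn hw ha

theorem word_evolved' (m : ℕ) (σ : ℕ → ZMod 2) :
    word rowV' rowW' endFamily' (m + 2) σ 0 (m + 3) 0 0 =
      word rowV' rowW' endFamily' (m + 1) (evolved σ) 0 (m + 2) 0 0 := by
  simp only [word, evolved_zero, evolved_one, evolved_shift]
  rw [shift'_start]
  refine rowV'_congr (m := m + 2) _ (rowW'_congr _ fun c w n a hn hw ha hl => ?_) _ _ _ _ le_rfl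
    fun _ => rfl
  exact shift'_word m (fun k => σ (k + 2)) c w n a hn hw ha hl

/-- At the first time step the two amplitudes add up to the local rule. -/
theorem word_one (σ : ℕ → ZMod 2) :
    word rowV rowW endFamily 1 σ 0 1 0 0 +
        word rowV' rowW' endFamily' 1 (fun k => σ (2 - k)) 0 2 0 0 =
      if chi (σ 0) (σ 1) (σ 2) = 1 then 1 else 0 := by
  obtain ⟨h₁, h₂, h₃, h₄, h₅, h₆, h₇, h₈⟩ := chi_values
  simp only [word, Nat.reduceSub, Nat.reduceAdd, Nat.sub_self]
  generalize σ 0 = s₀, σ 1 = s₁, σ 2 = s₂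
  rcases zmod_two_cases s₀ with rfl | rfl <;> rcases zmod_two_cases s₁ with rfl | rfl <;>
  rcases zmod_two_cases s₂ with rfl | rfl <;>
  simp [h₁, h₂, h₃, h₄, h₅, h₆, h₇, h₈, rowV, rowW, rowV', rowW', rowV₀, rowV₁, rowW₀, rowW₁,
    rowV₀', rowW₀', rowW₁', endFamily, endFamily']

/-! ### Amplitudes as iterated row operations -/

theorem coord_V (s : ZMod 2) (x : Aux) : coord (V s x) = rowV s (coord x) := by
  funext c w n a
  rcases zmod_two_cases s with rfl | rfl
  · exact coord_V₀ x c w n a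
  · exact coord_V₁ x c w n a

theorem coord_W (s : ZMod 2) (x : Aux) : coord (W s x) = rowW s (coord x) := by
  funext c w n a
  rcases zmod_two_cases s with rfl | rfl
  · exact coord_W₀ x c w n a
  · exact coord_W₁ x c w n a

/-- The values of a linear functional on the kets. -/
def values (φ : Aux →ₗ[ℂ] ℂ) : Family := fun c w n a => φ (ket c w n a)

/-- Precomposing a functional with an operator acts on its values by columns, so a product of primed
operators unfolds from its rightmost factor; hence the reversed strings below. -/
theorem values_V' (s : ZMod 2) (φ : Aux →ₗ[ℂ] ℂ) : values (φ ∘ₗ V' s) = rowV' s (values φ) := by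
  funext c w n a
  rcases zmod_two_cases s with rfl | rfl
  · exact map_V₀'_ket φ c w n a
  · exact map_V₁'_ket φ c w n a

theorem values_W' (s : ZMod 2) (φ : Aux →ₗ[ℂ] ℂ) : values (φ ∘ₗ W' s) = rowW' s (values φ) := by
  funext c w n a
  rcases zmod_two_cases s with rfl | rfl
  · exact map_W₀'_ket φ c w n a
  · exact map_W₁'_ket φ c w n a

theorem coord_rVec : coord rVec = endFamily := by
  funext c w n a
  fin_cases n <;> fin_cases a <;> rcases c with _ | c <;> rcases w with _ | w <;>
    simp [rVec, coord_add, coord_ket, endFamily]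

theorem values_lVec' : values lVec' = endFamily' := by
  funext c w n a
  fin_cases n <;> fin_cases a <;> rcases c with _ | c <;> rcases w with _ | _ | w <;>
    simp [values, lVec', bra_ket, endFamily']

theorem alternating_succ_left (A B : ZMod 2 → Module.End ℂ Aux) (m : ℕ) (σ : ℕ → ZMod 2) :
    alternating A B (fun k : Fin (2 * (m + 1) + 1) => σ k) =
      A (σ 0) * (B (σ 1) * alternating A B fun k : Fin (2 * m + 1) => σ (k + 2)) := by
  simp only [alternating]
  rw [show 2 * (m + 1) + 1 = 2 * m + 1 + 1 + 1 by ring, List.ofFn_succ, List.ofFn_succ]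
  simp [Nat.even_add, add_assoc]

theorem alternating_succ_right (A B : ZMod 2 → Module.End ℂ Aux) (m : ℕ) (σ : ℕ → ZMod 2) :
    alternating A B (fun k : Fin (2 * (m + 1) + 1) => σ k) =
      (alternating A B fun k : Fin (2 * m + 1) => σ k) * B (σ (2 * m + 1)) * A (σ (2 * m + 2)) := by
  simp only [alternating]
  rw [show 2 * (m + 1) + 1 = 2 * m + 1 + 1 + 1 by ring, List.ofFn_succ', List.ofFn_succ']
  simp [Nat.even_add, List.concat_eq_append, mul_assoc]

theorem alternating_zero (A B : ZMod 2 → Module.End ℂ Aux) (σ : ℕ → ZMod 2) :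
    alternating A B (fun k : Fin (2 * 0 + 1) => σ k) = A (σ 0) := by
  simp [alternating]

theorem coord_alternating (m : ℕ) (σ : ℕ → ZMod 2) :
    coord (alternating V W (fun k : Fin (2 * m + 1) => σ k) rVec) =
      word rowV rowW endFamily m σ := by
  induction m generalizing σ with
  | zero => rw [alternating_zero, coord_V, coord_rVec, word]
  | succ m ih =>
    rw [alternating_succ_left, word, ← ih, Module.End.mul_apply, Module.End.mul_apply, coord_V,
      coord_W]

theorem values_alternating (m : ℕ) (σ : ℕ → ZMod 2) :
    values (lVec' ∘ₗ alternating V' W' fun k : Fin (2 * m + 1) => σ k) =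
      word rowV' rowW' endFamily' m fun k => σ (2 * m - k) := by
  induction m with
  | zero => rw [alternating_zero, values_V', values_lVec', word]
  | succ m ih =>
    rw [alternating_succ_right, Module.End.mul_eq_comp, Module.End.mul_eq_comp,
      ← LinearMap.comp_assoc, values_V', ← LinearMap.comp_assoc, values_W', ih, word]
    have : (fun k => σ (2 * (m + 1) - (k + 2))) = fun k => σ (2 * m - k) := by
      funext k
      congr 1
      omega
    rw [this]
    rfl

theorem amplitude_eq (t : ℕ) (σ : ℕ → ZMod 2) :
    amplitude t (fun k => σ k) =
      word rowV rowW endFamily t σ 0 t 0 0 +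
        word rowV' rowW' endFamily' t (fun k => σ (2 * t - k)) 0 (t + 1) 0 0 := by
  rw [← coord_alternating, ← values_alternating]
  rfl

/-- Reflection commutes with the time step: `chi` is symmetric in its outer arguments, and
reflecting about the even number `2 * t` preserves parity. -/
theorem evolved_reverse (t : ℕ) (σ : ℕ → ZMod 2) (k : ℕ) (hk : k ≤ 2 * t) :
    evolved σ (2 * t - k) = evolved (fun k => σ (2 * (t + 1) - k)) k := by
  have e₁ : 2 * (t + 1) - k = 2 * t - k + 2 := by omega
  have e₂ : 2 * (t + 1) - (k + 1) = 2 * t - k + 1 := by omega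
  have e₃ : 2 * (t + 1) - (k + 2) = 2 * t - k := by omega
  simp only [evolved, e₁, e₂, e₃, Nat.even_sub hk, even_two_mul, true_iff]
  split_ifs
  · simp only [chi]
    ring
  · rfl

theorem word_congr (A B : ZMod 2 → Family → Family) (g : Family) (m : ℕ) {σ τ : ℕ → ZMod 2}
    (h : ∀ k ≤ 2 * m, σ k = τ k) : word A B g m σ = word A B g m τ := by
  induction m generalizing σ τ with
  | zero => rw [word, word, h 0 le_rfl]
  | succ m ih =>
    rw [word, word, h 0 (by omega), h 1 (by omega), ih fun k hk => h (k + 2) (by omega)]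

theorem amplitude_succ (m : ℕ) (σ : ℕ → ZMod 2) :
    amplitude (m + 2) (fun k => σ k) = amplitude (m + 1) fun k => evolved σ k := by
  rw [amplitude_eq, amplitude_eq, word_evolved, word_evolved',
    word_congr rowV' rowW' endFamily' (m + 1) fun k hk => evolved_reverse (m + 1) σ k hk]

/-! ### Time evolution of the configurations -/

theorem evolve_apply (t : ℕ) (s : Config) :
    evolve (site 0 1) (t + 1) s =
      amplitude (t + 1) fun k => s (((k : ℕ) : ℤ) - (t + 1 : ℕ)) := by
  induction t generalizing s with
  | zero =>
    rw [amplitude_eq 1 fun k => s ((k : ℤ) - ((0 + 1 : ℕ) : ℤ)), word_one]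
    change (if step 0 s 0 = 1 then (1 : ℂ) else 0) = _
    have : step 0 s 0 = chi (s (0 - 1)) (s 0) (s (0 + 1)) := by
      simp [step]
    rw [this]
    norm_num
  | succ t ih =>
    rw [amplitude_succ t fun k => s ((k : ℤ) - ((t + 1 + 1 : ℕ) : ℤ))]
    -- The latest propagator is outermost in `evolve`, so it acts on the configuration first.
    change evolve (site 0 1) (t + 1) (step (t + 1) s) = _
    rw [ih]
    congr 1
    funext k
    change (if (2 : ℤ) ∣ (k : ℕ) - ((t + 1 : ℕ) : ℤ) - ((t + 1 : ℕ) : ℤ) then _ else _) = _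
    -- The window at time t + 1 begins at the site -(t+1), which is itself updated, so the updated
    -- sites are those with even index.
    have hpar : (2 : ℤ) ∣ (k : ℕ) - ((t + 1 : ℕ) : ℤ) - ((t + 1 : ℕ) : ℤ) ↔ Even (k : ℕ) := by
      rw [Nat.even_iff]
      omega
    simp only [evolved, hpar]
    push_cast
    ring_nf

theorem cylinder_apply (t : ℕ) (σ : Fin (2 * t + 1) → ZMod 2) (s : Config) :
    cylinder 0 σ s = if σ = fun k : Fin (2 * t + 1) => s (((k : ℕ) : ℤ) - t) then 1 else 0 := by
  have hhalf : (2 * t + 1) / 2 = t := by omega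
  rw [cylinder, ContinuousMap.prod_apply, hhalf]
  change ∏ i : Fin (2 * t + 1), (if s (0 - (t : ℤ) + ((i : ℕ) : ℤ)) = σ i then (1 : ℂ) else 0) = _
  rw [Finset.prod_ite_zero]
  simp [funext_iff, neg_add_eq_sub, eq_comm]

end Rule54

end

theorem theorem1 (t : ℕ) (ht : 1 ≤ t) :
    Rule54.evolve (Rule54.site 0 1) t =
      ∑ s : Fin (2 * t + 1) → ZMod 2, Rule54.amplitude t s • Rule54.cylinder 0 s := by
  obtain ⟨t, rfl⟩ := Nat.exists_eq_add_of_le' ht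
  ext s
  rw [Rule54.evolve_apply, ContinuousMap.sum_apply]
  -- The cylinders are indicators of disjoint sets, so at a given configuration only the string it
  -- displays contributes.
  simp [Rule54.cylinder_apply]
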